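/- Let $\mathcal M$ be the set of all Borel probability measures on $\mathbb R$, and let $T:\mathcal M\to\mathcal M$ be the Quicksort transformation: for $\nu\in\mathcal M$, $T\nu$ is the distribution of $$U Z+(1-U)Z^*+g(U),\qquad g(u):=2u\ln u+2(1-u)\ln(1-u)+1,$$ where $U,Z,Z^*$ are independent, $Z\sim\nu$, $Z^*\sim\nu$, and $U$ is uniform on $(0,1)$. For $m\in\mathbb R$ and $\sigma\ge 0$ let $\mathrm{Cauchy}(m,\sigma)$ be the distribution of $m+\sigma C$, where $C$ has density $x\mapsto[\pi(1+x^2)]^{-1}$ on $\mathbb R$ (so $\mathrm{Cauchy}(m,0)$ is the unit mass at $m$). Theorem. Among the probability measures with finite variance and zero mean, $T$ has exactly one fixed point $\mu$ (the limiting Quicksort measure). The set $\mathcal F=\{\nu\in\mathcal M: T\nu=\nu\}$ of all fixed points of $T$ equals the set of all convolutions of $\mu$ with Cauchy distributions: $$\mathcal F=\{\mu*\mathrm{Cauchy}(m,\sigma): m\in\mathbb R,\ \sigma\ge 0\}.$$ Moreover, $(m,\sigma)\mapsto\mu*\mathrm{Cauchy}(m,\sigma)$ is a bijection from $\{(m,\sigma):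 m\in\mathbb R,\ \sigma\ge0\}$ onto $\mathcal F$. -/

import Mathlib

open MeasureTheory ProbabilityTheory
open scoped NNReal

namespace Quicksort

/-- The toll function `g(u) = 2 u ln u + 2 (1 - u) ln (1 - u) + 1`. -/
noncomputable def g (u : ℝ) : ℝ :=
  2 * u * Real.log u + 2 * (1 - u) * Real.log (1 - u) + 1

/-- The uniform distribution on the open interval `(0, 1)`. -/
noncomputable def unif01 : Measure ℝ := volume.restrict (Set.Ioo (0 : ℝ) 1)

instance : IsProbabilityMeasure unif01 := ⟨by simp [unif01]⟩

/-- The value `u z + (1 - u) z* + g(u)` as a function of `(u, (z, z*))`. -/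
noncomputable def combine (p : ℝ × (ℝ × ℝ)) : ℝ :=
  p.1 * p.2.1 + (1 - p.1) * p.2.2 + g p.1

theorem measurable_g : Measurable g := by
  unfold g
  fun_prop

theorem measurable_combine : Measurable combine := by
  have := measurable_g
  unfold combine
  fun_prop

/-- The Quicksort transformation: `T ν` is the distribution of `U Z + (1 - U) Z* + g(U)` for
independent `U ∼ unif(0, 1)`, `Z ∼ ν`, `Z* ∼ ν`, that is, the image under `combine` of the
product law of `(U, (Z, Z*))`. -/
noncomputable def T (ν : ProbabilityMeasure ℝ) : ProbabilityMeasure ℝ :=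
  ⟨(unif01.prod ((ν : Measure ℝ).prod (ν : Measure ℝ))).map combine,
    Measure.isProbabilityMeasure_map measurable_combine.aemeasurable⟩

/-- The class of all fixed points of `T`. -/
def fixedPoints : Set (ProbabilityMeasure ℝ) := {ν | T ν = ν}

/-- `μ` is a fixed point of `T` with finite variance and zero mean. -/
structure IsLimitLaw (μ : ProbabilityMeasure ℝ) : Prop where
  fixed : T μ = μ
  finite_variance : MemLp (fun x : ℝ => x) 2 (μ : Measure ℝ)
  zero_mean : ∫ x, x ∂(μ : Measure ℝ) = 0

/-- The convolution of `μ` with the Cauchy distribution of center `m` and scale `σ ≥ 0`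
(for `σ = 0`, `cauchyMeasure m 0` is the unit mass at `m`). -/
noncomputable def convCauchy (μ : ProbabilityMeasure ℝ) (m : ℝ) (σ : ℝ≥0) :
    ProbabilityMeasure ℝ :=
  ⟨(μ : Measure ℝ).conv (cauchyMeasure m σ), inferInstance⟩

/-- The class of all convolutions of `μ` with a Cauchy distribution. -/
def cauchyConvolutions (μ : ProbabilityMeasure ℝ) : Set (ProbabilityMeasure ℝ) :=
  {ν | ∃ (m : ℝ) (σ : ℝ≥0), ν = convCauchy μ m σ}

end Quicksort

/-!
A law `ν` with characteristic function `ψ` is a fixed point of `T` if and only if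
`ψ t = ∫₀¹ ψ (u t) ψ ((1 - u) t) exp (i t g u) du` for all `t` (`T_eq_self_iff`). Multiplying `ψ` by
the characteristic function `exp (i m t - σ |t|)` of a Cauchy law preserves this equation, since
`|t| = |u t| + |(1 - u) t|`. The converse rests on two facts.

* A solution is determined by its right derivative at `0` (`eq_of_hasDerivWithinAt`): if two
  solutions agree to first order, then `|ψ₁ - ψ₂| / t` tends to `0` at `0` and is dominated by a
  weighted average of its earlier values, so a maximum principle makes it vanish. Here `T` is
  nonexpansive for the metric `sup |ψ₁ - ψ₂| / t`.
* Every solution has a right derivative `c` at `0`, with `Re c ≤ 0`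
  (`exists_hasDerivWithinAt_charFun`). The linear part of the equation for `w = ψ - 1` reads
  `w t = 2 ∫₀¹ w (u t) du`, and if `w = O(t ^ α)` with `α > 1 / 2` then the remainder is so small
  that `w t / t` converges. The bound with `α = 3 / 4` comes from the modulus: `1 - |ψ|` dominates
  almost twice its own average, so its averages are `O(t ^ (3 / 4))`. This bounds the tails of the
  symmetrized law, hence those of `ν` itself, hence `w`; the phase of `ψ` is never needed.

A centered law of finite variance has derivative `0` at `0`. So it is the only such fixed point, and
a fixed point with `c = i m - σ` is its convolution with the Cauchy law of center `m` and scale `σ`;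
as `c` determines `(m, σ)`, the parametrization is injective. A centered fixed point of finite
variance exists because `T` contracts the metric `sup |ψ₁ - ψ₂| / t ^ 2` by the factor `2 / 3`
(`exists_isLimitLaw`).
-/

open Filter Topology Set
open scoped FourierTransform

namespace Quicksort

/-! ### The toll function and the action of `T` on characteristic functions -/

theorem continuous_g : Continuous g := by
  have h1 : Continuous fun u : ℝ => u * Real.log u := Real.continuous_mul_log
  have h2 : Continuous fun u : ℝ => (1 - u) * Real.log (1 - u) := h1.comp (by fun_prop)
  have : g = fun u => 2 * (u * Real.log u) + 2 * ((1 - u) * Real.log (1 - u)) + 1 := by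
    ext u; simp only [g]; ring
  rw [this]; fun_prop

theorem integral_unif01 {E : Type*} [NormedAddCommGroup E] [NormedSpace ℝ E] (f : ℝ → E) :
    ∫ u, f u ∂unif01 = ∫ u in (0 : ℝ)..1, f u := by
  rw [intervalIntegral.integral_of_le zero_le_one, integral_Ioc_eq_integral_Ioo, unif01]

theorem abs_g_le {u : ℝ} (h0 : 0 ≤ u) (h1 : u ≤ 1) : |g u| ≤ 5 := by
  have key : ∀ v : ℝ, 0 ≤ v → v ≤ 1 → |v * Real.log v| ≤ 1 := by
    intro v hv0 hv1
    rcases hv0.eq_or_lt with rfl | hv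
    · simp
    · have := Real.abs_log_mul_self_lt v hv hv1
      rw [mul_comm]; exact this.le
  have a := abs_le.1 (key u h0 h1)
  have b := abs_le.1 (key (1 - u) (by linarith) (by linarith))
  rw [g, abs_le]
  constructor <;> nlinarith

theorem integral_comp_one_sub {E : Type*} [NormedAddCommGroup E] [NormedSpace ℝ E] (f : ℝ → E) :
    ∫ u in (0 : ℝ)..1, f (1 - u) = ∫ u in (0 : ℝ)..1, f u := by
  simp [intervalIntegral.integral_comp_sub_left (fun u => f u)]

theorem integral_g : ∫ u in (0 : ℝ)..1, g u = 0 := by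
  have hc : Continuous fun u : ℝ => u * Real.log u := Real.continuous_mul_log
  have h1 : ∫ u in (0 : ℝ)..1, u * Real.log u = -1 / 4 := by
    have hd : ∀ x ∈ Ioo (0 : ℝ) 1,
        HasDerivAt (fun u : ℝ => u * (u * Real.log u) / 2 - u ^ 2 / 4) (x * Real.log x) x := by
      intro x hx
      have hx0 : x ≠ 0 := hx.1.ne'
      have := (((hasDerivAt_id x).mul ((hasDerivAt_id x).mul (Real.hasDerivAt_log hx0))).div_const
        2).sub (((hasDerivAt_id x).pow 2).div_const 4)
      refine this.congr_deriv ?_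
      simp
      field_simp
      ring
    rw [intervalIntegral.integral_eq_sub_of_hasDerivAt_of_le zero_le_one (by fun_prop) hd
      (hc.intervalIntegrable _ _)]
    norm_num
  have h2 : ∫ u in (0 : ℝ)..1, (1 - u) * Real.log (1 - u) = -1 / 4 := by
    rw [← h1]; exact integral_comp_one_sub fun u => u * Real.log u
  have : g = fun u => 2 * (u * Real.log u) + 2 * ((1 - u) * Real.log (1 - u)) + 1 := by
    ext u; simp only [g]; ring
  have hc2 : Continuous fun u : ℝ => (1 - u) * Real.log (1 - u) := hc.comp (by fun_prop)
  rw [this, intervalIntegral.integral_add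
    ((by fun_prop : Continuous _).intervalIntegrable _ _) (by simp),
    intervalIntegral.integral_add
    ((by fun_prop : Continuous _).intervalIntegrable _ _)
    ((by fun_prop : Continuous _).intervalIntegrable _ _),
    intervalIntegral.integral_const_mul, intervalIntegral.integral_const_mul, h1, h2]
  norm_num

/-- The action of the Quicksort transformation on characteristic functions. -/
noncomputable def charTransform (f : ℝ → ℂ) (t : ℝ) : ℂ :=
  ∫ u in (0 : ℝ)..1, f (u * t) * f ((1 - u) * t) * Complex.exp (t * g u * Complex.I)

theorem charFun_T (ν : ProbabilityMeasure ℝ) (t : ℝ) :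
    charFun (T ν : Measure ℝ) t = charTransform (charFun (ν : Measure ℝ)) t := by
  have hT : (T ν : Measure ℝ) =
      (unif01.prod ((ν : Measure ℝ).prod (ν : Measure ℝ))).map combine := rfl
  rw [hT, charFun_apply_real, integral_map measurable_combine.aemeasurable (by fun_prop)]
  have hm := measurable_combine
  rw [integral_prod _ ((integrable_const (1 : ℝ)).mono' (by fun_prop) (by
    refine ae_of_all _ fun p => ?_
    rw [← Complex.ofReal_mul, Complex.norm_exp_ofReal_mul_I])), integral_unif01, charTransform]
  congr 1 with u
  simp only [charFun_apply_real]
  rw [← integral_prod_mul (μ := (ν : Measure ℝ)) (ν := (ν : Measure ℝ))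
    (fun x : ℝ => Complex.exp (((u * t : ℝ) : ℂ) * x * Complex.I))
    (fun x : ℝ => Complex.exp ((((1 - u) * t : ℝ) : ℂ) * x * Complex.I)), ← integral_mul_const]
  congr 1 with p
  rw [← Complex.exp_add, ← Complex.exp_add]
  congr 1
  simp only [combine]
  push_cast
  ring

theorem T_eq_self_iff (ν : ProbabilityMeasure ℝ) :
    T ν = ν ↔ charTransform (charFun (ν : Measure ℝ)) = charFun (ν : Measure ℝ) := by
  constructor
  · intro h
    ext t
    rw [← charFun_T, h]
  · intro h
    refine Subtype.ext (Measure.ext_of_charFun (μ := (T ν : Measure ℝ)) (ν := (ν : Measure ℝ)) ?_)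
    ext t
    rw [charFun_T, h]

/-! ### Uniqueness given the right derivative at zero -/

theorem norm_charTransform_sub_le {f h : ℝ → ℂ} (hf : Continuous f) (hh : Continuous h)
    (hf1 : ∀ t, ‖f t‖ ≤ 1) (hh1 : ∀ t, ‖h t‖ ≤ 1) (t : ℝ) :
    ‖charTransform f t - charTransform h t‖ ≤ 2 * ∫ u in (0 : ℝ)..1, ‖f (u * t) - h (u * t)‖ := by
  have hg := continuous_g
  have hsymm := integral_comp_one_sub fun u => ‖f (u * t) - h (u * t)‖
  have hsum : ∫ u in (0 : ℝ)..1, (‖f (u * t) - h (u * t)‖ + ‖f ((1 - u) * t) - h ((1 - u) * t)‖)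
      = 2 * ∫ u in (0 : ℝ)..1, ‖f (u * t) - h (u * t)‖ := by
    rw [intervalIntegral.integral_add
      ((by fun_prop : Continuous _).intervalIntegrable _ _)
      ((by fun_prop : Continuous _).intervalIntegrable _ _), hsymm]
    ring
  rw [← hsum, charTransform, charTransform, ← intervalIntegral.integral_sub
      ((by fun_prop : Continuous _).intervalIntegrable _ _)
      ((by fun_prop : Continuous _).intervalIntegrable _ _)]
  refine intervalIntegral.norm_integral_le_of_norm_le zero_le_one (ae_of_all _ fun u _ => ?_)
    ((by fun_prop : Continuous _).intervalIntegrable _ _)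
  rw [← sub_mul, norm_mul, ← Complex.ofReal_mul, Complex.norm_exp_ofReal_mul_I, mul_one]
  have : f (u * t) * f ((1 - u) * t) - h (u * t) * h ((1 - u) * t)
      = (f (u * t) - h (u * t)) * f ((1 - u) * t)
        + h (u * t) * (f ((1 - u) * t) - h ((1 - u) * t)) := by ring
  rw [this]
  refine (norm_add_le _ _).trans ?_
  rw [norm_mul, norm_mul]
  gcongr
  · exact mul_le_of_le_one_right (norm_nonneg _) (hf1 _)
  · exact mul_le_of_le_one_left (norm_nonneg _) (hh1 _)

/-- Two fixed points of `charTransform` with the same right derivative at `0` coincide on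
`(0, ∞)`. By `norm_charTransform_sub_le`, the quotient `|f - h| / s` at a point is at most a
weighted average of its values to the left of that point; these tend to `0` near `0`, so the
quotient has no positive maximum on an interval `(0, t]`. -/
theorem eq_of_hasDerivWithinAt {f h : ℝ → ℂ} {c : ℂ} (hf : Continuous f) (hh : Continuous h)
    (hf1 : ∀ t, ‖f t‖ ≤ 1) (hh1 : ∀ t, ‖h t‖ ≤ 1) (h0 : f 0 = h 0)
    (hfT : charTransform f = f) (hhT : charTransform h = h)
    (hfd : HasDerivWithinAt f c (Ioi 0) 0) (hhd : HasDerivWithinAt h c (Ioi 0) 0)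
    {t : ℝ} (ht : 0 < t) : f t = h t := by
  by_contra hne
  set d : ℝ → ℝ := fun s => ‖f s - h s‖ with hd
  have hdc : Continuous d := by fun_prop
  have hdt : 0 < d t := norm_pos_iff.2 (sub_ne_zero.2 hne)
  have hε : 0 < d t / t / 2 := by positivity
  obtain ⟨δ, hδ0, hδ⟩ : ∃ δ > 0, ∀ s, 0 < s → s < δ → d s ≤ d t / t / 2 * s := by
    have := (hasDerivWithinAt_iff_isLittleO.1 (hfd.sub hhd)).def hε
    rw [eventually_nhdsWithin_iff, Metric.eventually_nhds_iff] at this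
    obtain ⟨δ, hδ0, hδ⟩ := this
    refine ⟨δ, hδ0, fun s hs hsδ => ?_⟩
    have := hδ (y := s) (by simpa [abs_of_pos hs] using hsδ) hs
    simpa [h0, abs_of_pos hs] using this
  have hδt : δ ≤ t := by
    by_contra! hlt
    have := hδ t ht hlt
    have h2 : d t / t / 2 * t = d t / 2 := by field_simp
    linarith
  -- The maximum of `d s / s` over `[δ, t]` is also a bound for it on `(0, δ)`, by `hδ`.
  obtain ⟨s, hs, hmax⟩ := isCompact_Icc.exists_isMaxOn (f := fun s => d s / s)
    (nonempty_Icc.2 hδt) (hdc.continuousOn.div continuousOn_id fun x hx => (hδ0.trans_le hx.1).ne')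
  have hs0 : 0 < s := hδ0.trans_le hs.1
  set M := d s / s with hM
  have hMt : d t / t ≤ M := hmax (right_mem_Icc.2 hδt)
  have hdM : d s = M * s := by rw [hM]; field_simp
  have hle : ∀ r, 0 < r → r ≤ s → d r ≤ M * r := by
    intro r hr hrs
    rcases lt_or_ge r δ with h1 | h1
    · refine (hδ r hr h1).trans ?_
      gcongr
      linarith
    · have : d r / r ≤ M := hmax ⟨h1, hrs.trans hs.2⟩
      rwa [div_le_iff₀ hr] at this
  have hint : d s ≤ 2 * ∫ u in (0 : ℝ)..1, d (u * s) := by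
    have := norm_charTransform_sub_le hf hh hf1 hh1 s
    rwa [hfT, hhT] at this
  have hpos : 0 < ∫ u in (0 : ℝ)..1, (2 * (M * s) * u - 2 * d (u * s)) := by
    refine intervalIntegral.integral_pos zero_lt_one (by fun_prop) ?_ ?_
    · intro u hu
      have := hle (u * s) (mul_pos hu.1 hs0) (mul_le_of_le_one_left hs0.le hu.2)
      linarith
    -- At `u = δ / (2 s)` the bound `hδ` is strictly better than `hle`.
    · refine ⟨δ / 2 / s, ⟨by positivity, ?_⟩, ?_⟩
      · rw [div_le_one hs0]; linarith [hs.1]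
      · have e : δ / 2 / s * s = δ / 2 := by field_simp
        have h1 := hδ (δ / 2) (by positivity) (by linarith)
        have h2 : d t / t / 2 * (δ / 2) < M * (δ / 2) := by
          have := mul_pos hε hδ0
          gcongr
          linarith
        have h3 : 2 * (M * s) * (δ / 2 / s) = 2 * (M * (δ / 2)) := by field_simp
        rw [e, h3]
        linarith
  rw [intervalIntegral.integral_sub
      ((by fun_prop : Continuous _).intervalIntegrable _ _)
      ((by fun_prop : Continuous _).intervalIntegrable _ _),
    intervalIntegral.integral_const_mul, intervalIntegral.integral_const_mul, integral_id] at hpos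
  linarith

/-! ### The characteristic function of the Cauchy distribution -/

theorem integrable_exp_neg_abs : Integrable fun x : ℝ => (Real.exp (-|x|) : ℂ) := by
  refine Integrable.ofReal ?_
  rw [← integrableOn_univ, ← Iic_union_Ioi (a := (0 : ℝ))]
  refine IntegrableOn.union ?_ ?_
  · refine (integrableOn_congr_fun (fun x hx => ?_) measurableSet_Iic).2 (integrableOn_exp_Iic 0)
    simp only [abs_of_nonpos (mem_Iic.1 hx), neg_neg]
    rfl
  · refine (integrableOn_congr_fun (fun x hx => ?_) measurableSet_Ioi).2
      (integrableOn_exp_neg_Ioi 0)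
    simp only [abs_of_pos (mem_Ioi.1 hx)]
    rfl

theorem fourier_exp_neg_abs (w : ℝ) :
    𝓕 (fun x : ℝ => (Real.exp (-|x|) : ℂ)) w = 2 * (1 + ((2 * Real.pi * w : ℝ) : ℂ) ^ 2)⁻¹ := by
  rw [Real.fourier_real_eq_integral_exp_smul]
  set y : ℝ := 2 * Real.pi * w with hy
  have hint : Integrable fun x : ℝ =>
      Complex.exp (↑(-2 * Real.pi * x * w) * Complex.I) • (Real.exp (-|x|) : ℂ) := by
    refine integrable_exp_neg_abs.norm.mono' (by fun_prop) (ae_of_all _ fun x => ?_)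
    rw [norm_smul, Complex.norm_exp_ofReal_mul_I, one_mul]
  rw [← setIntegral_univ, ← Iic_union_Ioi (a := (0 : ℝ)),
    setIntegral_union (Iic_disjoint_Ioi le_rfl) measurableSet_Ioi hint.integrableOn
      hint.integrableOn]
  have h1 : ∫ x in Iic (0 : ℝ),
      Complex.exp (↑(-2 * Real.pi * x * w) * Complex.I) • (Real.exp (-|x|) : ℂ)
      = 1 / (1 - y * Complex.I) := by
    have := integral_exp_mul_complex_Iic (a := 1 - y * Complex.I) (by simp) 0
    rw [Complex.ofReal_zero, mul_zero, Complex.exp_zero] at this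
    rw [← this]
    refine setIntegral_congr_fun measurableSet_Iic fun x hx => ?_
    simp only [abs_of_nonpos (mem_Iic.1 hx), smul_eq_mul, Complex.ofReal_exp, ← Complex.exp_add]
    congr 1
    rw [hy]; push_cast; ring
  have h2 : ∫ x in Ioi (0 : ℝ),
      Complex.exp (↑(-2 * Real.pi * x * w) * Complex.I) • (Real.exp (-|x|) : ℂ)
      = 1 / (1 + y * Complex.I) := by
    have := integral_exp_mul_complex_Ioi (a := -(1 + y * Complex.I)) (by simp) 0
    rw [Complex.ofReal_zero, mul_zero, Complex.exp_zero, neg_div_neg_eq] at this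
    rw [← this]
    refine setIntegral_congr_fun measurableSet_Ioi fun x hx => ?_
    simp only [abs_of_pos (mem_Ioi.1 hx), smul_eq_mul, Complex.ofReal_exp, ← Complex.exp_add]
    congr 1
    rw [hy]; push_cast; ring
  rw [h1, h2]
  have n1 : (1 - y * Complex.I) ≠ 0 := fun h => by simpa using congrArg Complex.re h
  have n2 : (1 + y * Complex.I) ≠ 0 := fun h => by simpa using congrArg Complex.re h
  have e : 1 + (y : ℂ) ^ 2 = (1 - y * Complex.I) * (1 + y * Complex.I) := by
    ring_nf; simp [Complex.I_sq]
  rw [e]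
  field_simp
  ring

/-- The Fourier transform of the standard Cauchy density, by Fourier inversion. -/
theorem integral_exp_mul_inv_one_add_sq (s : ℝ) :
    ∫ y : ℝ, Complex.exp (s * y * Complex.I) * ((1 + y ^ 2)⁻¹ : ℝ)
      = Real.pi * (Real.exp (-|s|) : ℂ) := by
  set f : ℝ → ℂ := fun x => (Real.exp (-|x|) : ℂ) with hf
  have hF : 𝓕 f = fun w => 2 * (((1 + (2 * Real.pi * w) ^ 2)⁻¹ : ℝ) : ℂ) := by
    ext w
    rw [hf, fourier_exp_neg_abs]
    push_cast
    rfl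
  have hFi : Integrable (𝓕 f) := by
    rw [hF]
    refine (Integrable.ofReal ?_).const_mul 2
    exact integrable_inv_one_add_sq.comp_mul_left' (R := 2 * Real.pi) (by positivity)
  have hfc : Continuous f := by fun_prop
  have := congrFun (hfc.fourierInv_fourier_eq integrable_exp_neg_abs hFi) s
  rw [Real.fourierInv_eq', hF] at this
  have hcv := Measure.integral_comp_mul_left (fun y : ℝ =>
    Complex.exp (s * y * Complex.I) * ((1 + y ^ 2)⁻¹ : ℝ)) (2 * Real.pi)
  have hpi : (Real.pi : ℂ) ≠ 0 := by exact_mod_cast Real.pi_ne_zero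
  have e : ∫ v : ℝ, Complex.exp (↑(2 * Real.pi * inner ℝ v s) * Complex.I) •
      (2 * (((1 + (2 * Real.pi * v) ^ 2)⁻¹ : ℝ) : ℂ))
      = 2 * ∫ v : ℝ, Complex.exp (s * ↑(2 * Real.pi * v) * Complex.I) *
        ((1 + (2 * Real.pi * v) ^ 2)⁻¹ : ℝ) := by
    rw [← integral_const_mul]
    congr 1 with v
    simp only [RCLike.inner_apply, conj_trivial, smul_eq_mul]
    push_cast
    ring_nf
  rw [e, hcv, abs_of_pos (by positivity : (0:ℝ) < (2 * Real.pi)⁻¹), Complex.real_smul] at this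
  rw [hf] at this
  simp only at this
  rw [← this, Complex.ofReal_inv, Complex.ofReal_mul, Complex.ofReal_ofNat, ← mul_assoc,
    ← mul_assoc, show (Real.pi : ℂ) * 2 * (2 * (Real.pi : ℂ))⁻¹ = 1 by field_simp, one_mul]

theorem charFun_cauchyMeasure (m : ℝ) (σ : ℝ≥0) (t : ℝ) :
    charFun (cauchyMeasure m σ) t = Complex.exp (t * m * Complex.I - σ * |t|) := by
  rcases eq_or_ne σ 0 with rfl | hσ
  · rw [cauchyMeasure_zero_scale, charFun_dirac]
    simp
  have hσ0 : (0 : ℝ) < σ := by positivity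
  have hσc : (σ : ℂ) ≠ 0 := by exact_mod_cast hσ0.ne'
  have hpi : (Real.pi : ℂ) ≠ 0 := by exact_mod_cast Real.pi_ne_zero
  rw [cauchyMeasure_of_scale_ne_zero m hσ, charFun_apply_real]
  unfold cauchyPDF
  rw [integral_withDensity_eq_integral_toReal_smul (by fun_prop) (by simp)]
  simp_rw [ENNReal.toReal_ofReal (cauchyPDF_pos m hσ _).le]
  have h1 := integral_exp_mul_inv_one_add_sq (t * σ)
  have h2 := Measure.integral_comp_div (fun y : ℝ =>
    Complex.exp ((t * σ : ℝ) * y * Complex.I) * ((1 + y ^ 2)⁻¹ : ℝ)) (σ : ℝ)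
  have h3 := integral_sub_right_eq_self (μ := volume) (fun x : ℝ =>
    Complex.exp ((t * σ : ℝ) * (x / σ : ℝ) * Complex.I) * ((1 + (x / σ) ^ 2)⁻¹ : ℝ)) m
  rw [h2, h1, abs_of_pos hσ0] at h3
  have e : ∀ x : ℝ, cauchyPDFReal m σ x • Complex.exp (t * x * Complex.I)
      = (Real.pi : ℂ)⁻¹ * (σ : ℂ)⁻¹ * Complex.exp (t * m * Complex.I) *
        (Complex.exp ((t * σ : ℝ) * ((x - m) / σ : ℝ) * Complex.I) *
          ((1 + ((x - m) / σ) ^ 2)⁻¹ : ℝ)) := by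
    intro x
    have : Complex.exp (t * x * Complex.I) = Complex.exp (t * m * Complex.I) *
        Complex.exp ((t * σ : ℝ) * ((x - m) / σ : ℝ) * Complex.I) := by
      rw [← Complex.exp_add]
      congr 1
      push_cast
      field_simp
      ring
    rw [cauchyPDFReal_def', this, Complex.real_smul]
    push_cast
    ring
  simp_rw [e]
  rw [integral_const_mul, h3, Complex.exp_sub, Complex.real_smul, abs_mul, abs_of_pos hσ0,
    Complex.ofReal_exp, div_eq_mul_inv (Complex.exp _), ← Complex.exp_neg, mul_comm |t|]
  push_cast
  field_simp

/-! ### Existence of a centered fixed point with finite variance -/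

theorem norm_exp_mul_I_sub_one_sub_le (x : ℝ) :
    ‖Complex.exp (x * Complex.I) - 1 - x * Complex.I‖ ≤ 3 * x ^ 2 := by
  have hn : ‖(x : ℂ) * Complex.I‖ = |x| := by simp
  rcases le_or_gt |x| 1 with h | h
  · have := Complex.norm_exp_sub_one_sub_id_le (x := x * Complex.I) (by rwa [hn])
    rw [hn, sq_abs] at this
    nlinarith [sq_nonneg x]
  · refine (norm_sub_le _ _).trans ?_
    have h1 : ‖Complex.exp (x * Complex.I) - 1‖ ≤ 1 + 1 := by
      refine (norm_sub_le _ _).trans ?_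
      rw [Complex.norm_exp_ofReal_mul_I, norm_one]
    rw [hn, ← sq_abs x]
    nlinarith

theorem hasDerivAt_charFun_zero {μ : Measure ℝ} [IsProbabilityMeasure μ]
    (h2 : MemLp (fun x : ℝ => x) 2 μ) :
    HasDerivAt (charFun μ) (Complex.I * ((∫ x, x ∂μ : ℝ) : ℂ)) 0 := by
  have h1 : MemLp id (1 : ℕ) μ := h2.mono_exponent (by norm_num)
  have hd := iteratedDeriv_charFun_zero h1
  have hc : ContDiff ℝ (1 : ℕ) (charFun μ) := contDiff_charFun h1
  have := (hc.differentiable (by norm_num) 0).hasDerivAt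
  rw [iteratedDeriv_one] at hd
  simpa [hd] using this

/-- A characteristic function within `O(t ^ 2)` of `1` belongs to a centered law with finite
second moment: apply Fatou's lemma to `2 n ^ 2 (1 - cos (x / n))`, which tends to `x ^ 2`. -/
theorem memLp_two_of_norm_charFun_sub_one_le {μ : Measure ℝ} [IsProbabilityMeasure μ] {C : ℝ}
    (hC : ∀ t, ‖charFun μ t - 1‖ ≤ C * t ^ 2) :
    MemLp (fun x : ℝ => x) 2 μ ∧ ∫ x, x ∂μ = 0 := by
  have hC0 : 0 ≤ C := by simpa using (norm_nonneg _).trans (hC 1)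
  have hmem : MemLp (fun x : ℝ => x) 2 μ := by
    rw [memLp_two_iff_integrable_sq (by fun_prop)]
    refine ⟨by fun_prop, ?_⟩
    rw [hasFiniteIntegral_iff_ofReal (ae_of_all _ fun x => sq_nonneg x)]
    set F : ℕ → ℝ → ℝ := fun n x => 2 * (n : ℝ) ^ 2 * (1 - Real.cos ((n : ℝ)⁻¹ * x)) with hF
    have hF0 : ∀ n x, 0 ≤ F n x := fun n x =>
      mul_nonneg (by positivity) (sub_nonneg.2 (Real.cos_le_one _))
    have hlim : ∀ x, Tendsto (fun n => F n x) atTop (𝓝 (x ^ 2)) := by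
      intro x
      have h1 : Tendsto (fun n : ℕ => (x * Real.sinc ((n : ℝ)⁻¹ * (x / 2))) ^ 2) atTop
          (𝓝 ((x * Real.sinc (0 * (x / 2))) ^ 2)) :=
        (((Real.continuous_sinc.tendsto _).comp
          (tendsto_inv_atTop_nhds_zero_nat.mul_const (x / 2))).const_mul x).pow 2
      rw [zero_mul, Real.sinc_zero, mul_one] at h1
      refine h1.congr' ?_
      filter_upwards [eventually_gt_atTop 0] with n hn
      have hn' : (n : ℝ) ≠ 0 := by positivity
      rcases eq_or_ne x 0 with rfl | hx
      · simp [hF]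
      · rw [Real.sinc_of_ne_zero (by positivity), hF]
        have : (n : ℝ)⁻¹ * x = 2 * ((n : ℝ)⁻¹ * (x / 2)) := by ring
        simp only
        rw [this, Real.cos_two_mul, Real.cos_sq']
        field_simp
        ring
    have hFi : ∀ n, ∫⁻ x, ENNReal.ofReal (F n x) ∂μ ≤ ENNReal.ofReal (2 * C) := by
      intro n
      have hint : Integrable (fun x : ℝ => Real.cos ((n : ℝ)⁻¹ * x)) μ :=
        (integrable_const (1 : ℝ)).mono' (by fun_prop)
          (ae_of_all _ fun x => by simpa using Real.abs_cos_le_one _)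
      have hFint : Integrable (F n) μ := ((integrable_const 1).sub hint).const_mul _
      rw [← ofReal_integral_eq_lintegral_ofReal hFint (ae_of_all _ (hF0 n))]
      refine ENNReal.ofReal_le_ofReal ?_
      rw [integral_const_mul, integral_sub (integrable_const _) hint]
      have hre : ∫ x, Real.cos ((n : ℝ)⁻¹ * x) ∂μ = (charFun μ (n : ℝ)⁻¹).re := by
        rw [charFun_apply_real, ← RCLike.re_eq_complex_re, ← integral_re]
        · congr 1 with x
          rw [RCLike.re_eq_complex_re, ← Complex.ofReal_mul, Complex.exp_ofReal_mul_I_re]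
        · refine (integrable_const (1 : ℝ)).mono' (by fun_prop) (ae_of_all _ fun x => ?_)
          rw [← Complex.ofReal_mul, Complex.norm_exp_ofReal_mul_I]
      rw [hre]
      have h1 : 1 - (charFun μ (n : ℝ)⁻¹).re ≤ C * ((n : ℝ)⁻¹) ^ 2 := by
        have := (Complex.abs_re_le_norm (charFun μ (n : ℝ)⁻¹ - 1)).trans (hC _)
        simp only [Complex.sub_re, Complex.one_re] at this
        linarith [(abs_le.1 this).1]
      rcases eq_or_ne n 0 with rfl | hn
      · simpa using hC0
      · have hn' : (n : ℝ) ≠ 0 := by positivity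
        calc 2 * (n : ℝ) ^ 2 * (∫ _, (1 : ℝ) ∂μ - (charFun μ (n : ℝ)⁻¹).re)
            ≤ 2 * (n : ℝ) ^ 2 * (C * ((n : ℝ)⁻¹) ^ 2) := by
              gcongr
              simpa using h1
          _ = 2 * C := by field_simp
    calc ∫⁻ x, ENNReal.ofReal (x ^ 2) ∂μ
        = ∫⁻ x, liminf (fun n => ENNReal.ofReal (F n x)) atTop ∂μ := by
          congr 1 with x
          exact ((ENNReal.continuous_ofReal.tendsto _).comp (hlim x)).liminf_eq.symm
      _ ≤ liminf (fun n => ∫⁻ x, ENNReal.ofReal (F n x) ∂μ) atTop :=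
          lintegral_liminf_le fun n => by fun_prop
      _ ≤ liminf (fun _ : ℕ => ENNReal.ofReal (2 * C)) atTop :=
          liminf_le_liminf (Eventually.of_forall hFi)
      _ < ⊤ := by rw [liminf_const]; exact ENNReal.ofReal_lt_top
  refine ⟨hmem, ?_⟩
  have hd : HasDerivAt (charFun μ) 0 0 := by
    rw [hasDerivAt_iff_isLittleO]
    have hO : (fun t : ℝ => charFun μ t - charFun μ 0 - (t - 0) • (0 : ℂ)) =O[𝓝 0]
        fun t : ℝ => t ^ 2 := by
      refine Asymptotics.IsBigO.of_bound C (Eventually.of_forall fun t => ?_)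
      simpa using hC t
    refine hO.trans_isLittleO ?_
    simpa using Asymptotics.isLittleO_pow_id (𝕜 := ℝ) one_lt_two
  simpa using (hasDerivAt_charFun_zero hmem).unique hd

/-- `charTransform` contracts the metric `sup |f t - h t| / t ^ 2` by the factor `2 / 3`. -/
theorem norm_charTransform_sub_le_sq {f h : ℝ → ℂ} (hf : Continuous f) (hh : Continuous h)
    (hf1 : ∀ t, ‖f t‖ ≤ 1) (hh1 : ∀ t, ‖h t‖ ≤ 1) {D : ℝ} (hD : ∀ t, ‖f t - h t‖ ≤ D * t ^ 2)
    (t : ℝ) : ‖charTransform f t - charTransform h t‖ ≤ D * (2 / 3) * t ^ 2 := by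
  refine (norm_charTransform_sub_le hf hh hf1 hh1 t).trans ?_
  have : ∫ u in (0 : ℝ)..1, ‖f (u * t) - h (u * t)‖ ≤ ∫ u in (0 : ℝ)..1, D * t ^ 2 * u ^ 2 := by
    refine intervalIntegral.integral_mono_on zero_le_one
      ((by fun_prop : Continuous _).intervalIntegrable _ _)
      ((by fun_prop : Continuous _).intervalIntegrable _ _) fun u _ => (hD _).trans_eq (by ring)
  rw [intervalIntegral.integral_const_mul, integral_pow] at this
  norm_num at this
  linarith

/-- The unit mass at `0`, with characteristic function `1`, is at finite distance from its image
because the toll function has mean zero. -/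
theorem norm_charTransform_one_sub_one_le (t : ℝ) :
    ‖charTransform (fun _ => 1) t - 1‖ ≤ 75 * t ^ 2 := by
  have hg := continuous_g
  have e : charTransform (fun _ => 1) t - 1 =
      ∫ u in (0 : ℝ)..1, (Complex.exp ((t * g u : ℝ) * Complex.I) - 1
        - (t * g u : ℝ) * Complex.I) := by
    have h0 : ∫ u in (0 : ℝ)..1, ((t * g u : ℝ) : ℂ) * Complex.I = 0 := by
      rw [intervalIntegral.integral_mul_const, intervalIntegral.integral_ofReal,
        intervalIntegral.integral_const_mul, integral_g]
      simp
    rw [intervalIntegral.integral_sub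
      ((by fun_prop : Continuous _).intervalIntegrable _ _)
      ((by fun_prop : Continuous _).intervalIntegrable _ _), h0, intervalIntegral.integral_sub
      ((by fun_prop : Continuous _).intervalIntegrable _ _) (by simp), charTransform]
    simp
  rw [e]
  refine (intervalIntegral.norm_integral_le_of_norm_le_const (C := 75 * t ^ 2)
    fun u hu => ?_).trans (by simp)
  rw [uIoc_of_le zero_le_one] at hu
  refine (norm_exp_mul_I_sub_one_sub_le _).trans ?_
  have := abs_g_le hu.1.le hu.2
  have h2 : g u ^ 2 ≤ 25 := by rw [← sq_abs]; nlinarith [abs_nonneg (g u)]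
  nlinarith [mul_le_mul_of_nonneg_left h2 (sq_nonneg t)]

/-- A law with finite variance and mean zero which is fixed by `T`, as the limit of the iterates
of `T` at the unit mass at `0`. -/
theorem exists_isLimitLaw : ∃ μ : ProbabilityMeasure ℝ, IsLimitLaw μ := by
  -- By the contraction property the characteristic functions converge geometrically, uniformly in
  -- `t` relative to `t ^ 2`; the limit is a characteristic function by tightness.
  let ν : ℕ → ProbabilityMeasure ℝ := fun n => T^[n] ⟨Measure.dirac 0, inferInstance⟩
  have hν0 : ∀ t, charFun (ν 0 : Measure ℝ) t = 1 := by
    intro t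
    change charFun (Measure.dirac (0 : ℝ)) t = 1
    simp [charFun_dirac]
  have hνs : ∀ n t, charFun (ν (n + 1) : Measure ℝ) t
      = charTransform (charFun (ν n : Measure ℝ)) t := by
    intro n t
    have : ν (n + 1) = T (ν n) := Function.iterate_succ_apply' _ _ _
    rw [this, charFun_T]
  have hcont : ∀ n, Continuous (charFun (ν n : Measure ℝ)) := fun n => continuous_charFun
  have hle : ∀ n t, ‖charFun (ν n : Measure ℝ) t‖ ≤ 1 := fun n t => norm_charFun_le_one t
  have hstep : ∀ n t, ‖charFun (ν n : Measure ℝ) t - charFun (ν (n + 1) : Measure ℝ) t‖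
      ≤ 75 * (2 / 3) ^ n * t ^ 2 := by
    intro n
    induction n with
    | zero =>
      intro t
      rw [hνs, funext hν0, norm_sub_rev]
      simpa using norm_charTransform_one_sub_one_le t
    | succ n ih =>
      intro t
      rw [hνs n, hνs (n + 1), pow_succ, ← mul_assoc]
      exact norm_charTransform_sub_le_sq (hcont _) (hcont _) (hle _) (hle _) ih t
  have hgeo : ∀ t n, dist (charFun (ν n : Measure ℝ) t) (charFun (ν (n + 1) : Measure ℝ) t)
      ≤ 75 * t ^ 2 * (2 / 3) ^ n := fun t n => by
    rw [dist_eq_norm]; exact (hstep n t).trans_eq (by ring)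
  have hr : (2 / 3 : ℝ) < 1 := by norm_num
  choose f hf using fun t => cauchySeq_tendsto_of_complete
    (cauchySeq_of_le_geometric _ _ hr (hgeo t))
  have hfd : ∀ n t, ‖charFun (ν n : Measure ℝ) t - f t‖ ≤ 225 * (2 / 3) ^ n * t ^ 2 := by
    intro n t
    rw [← dist_eq_norm]
    refine (dist_le_of_le_geometric_of_tendsto _ _ hr (hgeo t) (hf t) n).trans_eq ?_
    ring
  have hf1 : ∀ t, ‖f t - 1‖ ≤ 225 * t ^ 2 := by
    intro t
    have := hfd 0 t
    rwa [hν0, norm_sub_rev, pow_zero, mul_one] at this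
  have hfc : ContinuousAt f 0 := by
    have h0 : f 0 = 1 := by simpa [sub_eq_zero] using hf1 0
    rw [ContinuousAt, h0, tendsto_iff_norm_sub_tendsto_zero]
    refine squeeze_zero (fun _ => norm_nonneg _) hf1 ?_
    have : Continuous fun t : ℝ => 225 * t ^ 2 := by fun_prop
    simpa using this.tendsto 0
  have htight := isTightMeasureSet_of_tendsto_charFun (μ := fun n => (ν n : Measure ℝ)) hfc hf
  have hcomp : IsCompact (closure (range ν)) := by
    refine isCompact_closure_of_isTightMeasureSet ?_
    convert! htight
    ext; simp
  obtain ⟨μ, -, hμ⟩ := hcomp.ultrafilter_le_nhds ((hyperfilter ℕ).map ν) (by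
    refine le_principal_iff.2 (mem_of_superset (range_mem_map) subset_closure))
  have hμ' : Tendsto ν (hyperfilter ℕ : Filter ℕ) (𝓝 μ) := hμ
  have hchar : charFun (μ : Measure ℝ) = f := by
    ext t
    refine tendsto_nhds_unique ?_ ((hf t).mono_left Nat.hyperfilter_le_atTop)
    rw [ProbabilityMeasure.tendsto_iff_forall_integral_rclike_tendsto ℂ] at hμ'
    simp_rw [charFun_eq_integral_innerProbChar]
    exact hμ' _
  rw [← hchar] at hf1 hfd hf
  have hm := memLp_two_of_norm_charFun_sub_one_le hf1
  refine ⟨μ, (T_eq_self_iff μ).2 ?_, hm.1, hm.2⟩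
  ext t
  refine tendsto_nhds_unique ?_ ((hf t).comp (tendsto_add_atTop_nat 1))
  rw [tendsto_iff_norm_sub_tendsto_zero]
  refine squeeze_zero (fun _ => norm_nonneg _) (fun n => ?_)
    (g := fun n => 225 * (2 / 3 : ℝ) ^ n * (2 / 3) * t ^ 2) ?_
  · simp only [Function.comp_apply]
    rw [hνs]
    exact norm_charTransform_sub_le_sq (hcont _) continuous_charFun (hle _)
      (fun _ => norm_charFun_le_one _) (hfd n) t
  · have := tendsto_pow_atTop_nhds_zero_of_lt_one (by norm_num : (0 : ℝ) ≤ 2 / 3) hr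
    simpa using ((this.const_mul 225).mul_const (2 / 3)).mul_const (t ^ 2)

/-! ### Functions compared with twice their own average -/

theorem integral_comp_mul_eq_div {E : Type*} [NormedAddCommGroup E] [NormedSpace ℝ E]
    (f : ℝ → E) {t : ℝ} (ht : t ≠ 0) :
    ∫ u in (0 : ℝ)..1, f (u * t) = t⁻¹ • ∫ s in (0 : ℝ)..t, f s := by
  rw [intervalIntegral.integral_comp_mul_right f ht]
  simp

/-- If `w t` equals twice its average over `[0, t]` up to `O(t ^ (3 / 2))`, then `w t / t` converges
as `t ↓ 0`. With `W t = ∫₀ᵗ w`, the function `W t / t ^ 2` has derivative `O(t ^ (-1 / 2))`, so it is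
Lipschitz as a function of `s = √t`. -/
theorem exists_tendsto_div_of_average {w : ℝ → ℂ} (hw : Continuous w) {K : ℝ}
    (hK : ∀ t, 0 < t → t ≤ 1 →
      ‖w t - 2 * ∫ u in (0 : ℝ)..1, w (u * t)‖ ≤ K * t ^ (3 / 2 : ℝ)) :
    ∃ c : ℂ, Tendsto (fun t : ℝ => w t / t) (𝓝[>] 0) (𝓝 c) := by
  have hrpow : ∀ s : ℝ, 0 < s → (s ^ 2) ^ (3 / 2 : ℝ) = s ^ 3 := by
    intro s hs
    rw [← Real.rpow_natCast, ← Real.rpow_natCast, ← Real.rpow_mul hs.le]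
    norm_num
  set W : ℝ → ℂ := fun t => ∫ s in (0 : ℝ)..t, w s with hW
  have hWd : ∀ t, HasDerivAt W (w t) t := fun t => hw.integral_hasStrictDerivAt 0 t |>.hasDerivAt
  have hbound : ∀ s : ℝ, 0 < s → s ≤ 1 →
      ‖w (s ^ 2) - 2 * ((s : ℂ) ^ 2)⁻¹ * W (s ^ 2)‖ ≤ K * s ^ 3 := by
    intro s hs hs1
    have := hK (s ^ 2) (by positivity) (pow_le_one₀ hs.le hs1)
    rw [hrpow s hs, integral_comp_mul_eq_div w (by positivity), Complex.real_smul] at this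
    rw [mul_assoc]
    push_cast at this
    exact this
  set G : ℝ → ℂ := fun s => W (s ^ 2) / (s : ℂ) ^ 4 with hG
  have hGd : ∀ s : ℝ, 0 < s → HasDerivAt G
      (2 * ((s : ℂ) ^ 3)⁻¹ * (w (s ^ 2) - 2 * ((s : ℂ) ^ 2)⁻¹ * W (s ^ 2))) s := by
    intro s hs
    have hsc : (s : ℂ) ≠ 0 := by exact_mod_cast hs.ne'
    have h1 : HasDerivAt (fun s : ℝ => W (s ^ 2)) ((2 * s) • w (s ^ 2)) s := by
      refine ((hWd (s ^ 2)).scomp s (hasDerivAt_pow 2 s)).congr_deriv ?_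
      simp
    have h2 : HasDerivAt (fun s : ℝ => (s : ℂ) ^ 4) (4 * (s : ℂ) ^ 3) s := by
      exact ((Complex.ofRealCLM.hasDerivAt (x := s)).pow 4).congr_deriv (by simp)
    refine (h1.div h2 (pow_ne_zero _ hsc)).congr_deriv ?_
    rw [Complex.real_smul]
    push_cast
    field_simp
    ring
  have hGb : ∀ s : ℝ, s ∈ Ioo (0 : ℝ) 1 →
      ‖2 * ((s : ℂ) ^ 3)⁻¹ * (w (s ^ 2) - 2 * ((s : ℂ) ^ 2)⁻¹ * W (s ^ 2))‖ ≤ 2 * K := by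
    intro s hs
    rw [norm_mul, norm_mul, norm_inv, norm_pow, Complex.norm_real, Real.norm_of_nonneg hs.1.le]
    have := hbound s hs.1 hs.2.le
    have hs3 : 0 < s ^ 3 := pow_pos hs.1 3
    calc ‖(2 : ℂ)‖ * (s ^ 3)⁻¹ * ‖w (s ^ 2) - 2 * ((s : ℂ) ^ 2)⁻¹ * W (s ^ 2)‖
        ≤ 2 * (s ^ 3)⁻¹ * (K * s ^ 3) := by
          rw [Complex.norm_ofNat]
          gcongr
      _ = 2 * K := by rw [mul_comm K, mul_assoc, inv_mul_cancel_left₀ hs3.ne']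
  have hlip : LipschitzOnWith (2 * K).toNNReal G (Ioo 0 1) :=
    (convex_Ioo (0 : ℝ) 1).lipschitzOnWith_of_nnnorm_hasDerivWithin_le
      (fun s hs => (hGd s hs.1).hasDerivWithinAt) fun s hs => by
        rw [← NNReal.coe_le_coe, coe_nnnorm]
        exact (hGb s hs).trans (Real.le_coe_toNNReal _)
  obtain ⟨L, hL⟩ : ∃ L, Tendsto G (𝓝[>] 0) (𝓝 L) := by
    have hc : Cauchy (𝓝[Ioo (0 : ℝ) 1] 0) := by
      rw [nhdsWithin_Ioo_eq_nhdsGT zero_lt_one]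
      exact (cauchy_nhds (a := (0 : ℝ))).mono nhdsWithin_le_nhds
    have := hc.map_of_le hlip.uniformContinuousOn (by exact inf_le_right)
    rw [nhdsWithin_Ioo_eq_nhdsGT zero_lt_one] at this
    exact cauchy_map_iff_exists_tendsto.1 this
  refine ⟨2 * L, ?_⟩
  have hs0 : Tendsto (fun s : ℝ => w (s ^ 2) / (s : ℂ) ^ 2) (𝓝[>] 0) (𝓝 (2 * L)) := by
    have h1 : Tendsto (fun s : ℝ => w (s ^ 2) / (s : ℂ) ^ 2 - 2 * G s) (𝓝[>] 0) (𝓝 0) := by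
      have hz : Tendsto (fun s : ℝ => K * s) (𝓝[>] 0) (𝓝 0) := by
        have : Continuous fun s : ℝ => K * s := by fun_prop
        simpa using (this.tendsto 0).mono_left nhdsWithin_le_nhds
      refine squeeze_zero_norm' ?_ hz
      filter_upwards [Ioo_mem_nhdsGT (zero_lt_one (α := ℝ))] with s hs
      have hsc : (s : ℂ) ≠ 0 := by exact_mod_cast hs.1.ne'
      have e : w (s ^ 2) / (s : ℂ) ^ 2 - 2 * G s =
          ((s : ℂ) ^ 2)⁻¹ * (w (s ^ 2) - 2 * ((s : ℂ) ^ 2)⁻¹ * W (s ^ 2)) := by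
        rw [hG]; field_simp
      have hs2 : 0 < s ^ 2 := pow_pos hs.1 2
      rw [e, norm_mul, norm_inv, norm_pow, Complex.norm_real, Real.norm_of_nonneg hs.1.le,
        inv_mul_le_iff₀ hs2]
      exact (hbound s hs.1 hs.2.le).trans_eq (by ring)
    simpa using h1.add (hL.const_mul 2)
  have hsqrt : Tendsto Real.sqrt (𝓝[>] 0) (𝓝[>] 0) := by
    refine tendsto_nhdsWithin_iff.2 ⟨?_, ?_⟩
    · simpa using (Real.continuous_sqrt.tendsto 0).mono_left nhdsWithin_le_nhds
    · filter_upwards [self_mem_nhdsWithin] with t ht using Real.sqrt_pos.2 ht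
  refine (hs0.comp hsqrt).congr' ?_
  filter_upwards [self_mem_nhdsWithin] with t ht
  simp only [Function.comp_apply]
  rw [← Complex.ofReal_pow, Real.sq_sqrt (le_of_lt ht)]

/-- A function `q` with values in `[0, 1]`, vanishing at `0`, for which `1 - q` satisfies the
fixed-point inequality `1 - q t ≤ ∫ (1 - q (u t)) (1 - q ((1 - u) t)) du`, has `∫₀ᵗ q` of order
`t ^ (7 / 4)`. -/
theorem exists_integral_le_rpow {q : ℝ → ℝ} (hq : Continuous q) (h0 : q 0 = 0)
    (hq0 : ∀ t, 0 ≤ q t) (hq1 : ∀ t, q t ≤ 1)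
    (h : ∀ t, ∫ u in (0 : ℝ)..1, (q (u * t) + q ((1 - u) * t) - q (u * t) * q ((1 - u) * t))
      ≤ q t) :
    ∃ C : ℝ, 0 ≤ C ∧ ∀ t, 0 < t → ∫ s in (0 : ℝ)..t, q s ≤ C * t ^ (7 / 4 : ℝ) := by
  obtain ⟨δ, hδ0, hδ⟩ : ∃ δ > 0, ∀ s, 0 ≤ s → s ≤ δ → q s ≤ 1 / 4 := by
    have := (hq.tendsto 0).eventually (ge_mem_nhds (by rw [h0]; norm_num : q 0 < 1 / 4))
    obtain ⟨δ, hδ0, hδ⟩ := Metric.eventually_nhds_iff.1 this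
    refine ⟨δ / 2, by positivity, fun s hs hsδ => hδ ?_⟩
    rw [Real.dist_eq, sub_zero, abs_of_nonneg hs]
    linarith
  set Q : ℝ → ℝ := fun t => ∫ s in (0 : ℝ)..t, q s with hQ
  have hQd : ∀ t, HasDerivAt Q (q t) t := fun t => (hq.integral_hasStrictDerivAt 0 t).hasDerivAt
  -- While `q ≤ 1 / 4`, the product term is at most an eighth of the sum; hence `7 / 4`.
  have hQq : ∀ t, 0 < t → t ≤ δ → 7 / 4 * (t⁻¹ * Q t) ≤ q t := by
    intro t ht htδ
    refine le_trans ?_ (h t)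
    have hsymm := integral_comp_one_sub fun u => q (u * t)
    have hsum : ∫ u in (0 : ℝ)..1, (7 / 8 * q (u * t) + 7 / 8 * q ((1 - u) * t))
        = 7 / 4 * ∫ u in (0 : ℝ)..1, q (u * t) := by
      rw [intervalIntegral.integral_add
        ((by fun_prop : Continuous _).intervalIntegrable _ _)
        ((by fun_prop : Continuous _).intervalIntegrable _ _), intervalIntegral.integral_const_mul,
        intervalIntegral.integral_const_mul, hsymm]
      ring
    rw [integral_comp_mul_eq_div q ht.ne', smul_eq_mul] at hsum
    rw [← hsum]
    refine intervalIntegral.integral_mono_on zero_le_one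
      ((by fun_prop : Continuous _).intervalIntegrable _ _)
      ((by fun_prop : Continuous _).intervalIntegrable _ _) fun u hu => ?_
    have a := hδ (u * t) (mul_nonneg hu.1 ht.le) ((mul_le_of_le_one_left ht.le hu.2).trans htδ)
    have b := hδ ((1 - u) * t) (mul_nonneg (by linarith [hu.2]) ht.le)
      ((mul_le_of_le_one_left ht.le (by linarith [hu.1])).trans htδ)
    nlinarith [hq0 (u * t), hq0 ((1 - u) * t)]
  -- `t Q' ≥ (7 / 4) Q` near `0` makes `Q t * t ^ (-7 / 4)` nondecreasing there.
  have hmono : MonotoneOn (fun t => Q t * t ^ (-(7 / 4) : ℝ)) (Ioc 0 δ) := by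
    have hd : ∀ t, 0 < t → HasDerivAt (fun t => Q t * t ^ (-(7 / 4) : ℝ))
        (q t * t ^ (-(7 / 4) : ℝ) + Q t * (-(7 / 4) * t ^ (-(7 / 4) - 1 : ℝ))) t :=
      fun t ht => (hQd t).mul (Real.hasDerivAt_rpow_const (Or.inl ht.ne'))
    refine monotoneOn_of_deriv_nonneg (convex_Ioc 0 δ)
      (fun t ht => (hd t ht.1).continuousAt.continuousWithinAt) ?_ ?_
    · rw [interior_Ioc]
      exact fun t ht => (hd t ht.1).differentiableAt.differentiableWithinAt
    · rw [interior_Ioc]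
      intro t ht
      rw [(hd t ht.1).deriv, Real.rpow_sub_one ht.1.ne']
      have e : q t * t ^ (-(7 / 4) : ℝ) + Q t * (-(7 / 4) * (t ^ (-(7 / 4) : ℝ) / t))
          = t ^ (-(7 / 4) : ℝ) * (q t - 7 / 4 * (t⁻¹ * Q t)) := by
        rw [div_eq_mul_inv]; ring
      rw [e]
      exact mul_nonneg (Real.rpow_nonneg ht.1.le _) (sub_nonneg.2 (hQq t ht.1 ht.2.le))
  have hQ0 : ∀ t, 0 ≤ t → 0 ≤ Q t := fun t ht =>
    intervalIntegral.integral_nonneg ht fun u _ => hq0 u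
  have hQt : ∀ t, 0 < t → Q t ≤ t := by
    intro t ht
    have : Q t ≤ ∫ _ in (0 : ℝ)..t, (1 : ℝ) := intervalIntegral.integral_mono_on ht.le
      (hq.intervalIntegrable _ _) (by simp) fun u _ => hq1 u
    simpa using this
  have hC : 0 ≤ Q δ * δ ^ (-(7 / 4) : ℝ) :=
    mul_nonneg (hQ0 _ hδ0.le) (Real.rpow_nonneg hδ0.le _)
  refine ⟨Q δ * δ ^ (-(7 / 4) : ℝ) + δ ^ (-(3 / 4) : ℝ), by positivity, fun t ht => ?_⟩
  have htp : 0 < t ^ (7 / 4 : ℝ) := Real.rpow_pos_of_pos ht _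
  rcases le_or_gt t δ with hle | hlt
  · have h1 := hmono ⟨ht, hle⟩ ⟨hδ0, le_rfl⟩ hle
    simp only at h1
    have h2 : Q t = Q t * t ^ (-(7 / 4) : ℝ) * t ^ (7 / 4 : ℝ) := by
      rw [mul_assoc, ← Real.rpow_add ht]; norm_num
    change Q t ≤ _
    rw [h2]
    gcongr
    linarith [Real.rpow_pos_of_pos hδ0 (-(3 / 4) : ℝ)]
  · have h1 : t = t ^ (-(3 / 4) : ℝ) * t ^ (7 / 4 : ℝ) := by
      rw [← Real.rpow_add ht]; norm_num
    have h2 : t ^ (-(3 / 4) : ℝ) ≤ δ ^ (-(3 / 4) : ℝ) :=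
      Real.rpow_le_rpow_of_nonpos hδ0 hlt.le (by norm_num)
    refine (hQt t ht).trans ?_
    calc t = t ^ (-(3 / 4) : ℝ) * t ^ (7 / 4 : ℝ) := h1
      _ ≤ _ := by gcongr; linarith

/-! ### Tails of a fixed point and smoothness of its characteristic function at zero -/

/-- The law of the difference of two independent variables with law `ν`. -/
noncomputable def symmetrization (ν : Measure ℝ) : Measure ℝ :=
  ν.conv (ν.map ((-1 : ℝ) * ·))

instance (ν : Measure ℝ) [IsProbabilityMeasure ν] : IsProbabilityMeasure (symmetrization ν) := by
  have : IsProbabilityMeasure (ν.map ((-1 : ℝ) * ·)) :=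
    Measure.isProbabilityMeasure_map (by fun_prop)
  unfold symmetrization
  infer_instance

theorem charFun_symmetrization (ν : Measure ℝ) [IsProbabilityMeasure ν] (t : ℝ) :
    charFun (symmetrization ν) t = ((‖charFun ν t‖ ^ 2 : ℝ) : ℂ) := by
  have : IsProbabilityMeasure (ν.map ((-1 : ℝ) * ·)) :=
    Measure.isProbabilityMeasure_map (by fun_prop)
  rw [symmetrization, charFun_conv, charFun_map_mul, neg_one_mul, charFun_neg, Complex.mul_conj']
  push_cast
  rfl

theorem exists_tail_le_symmetrization (ν : Measure ℝ) [IsProbabilityMeasure ν] :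
    ∃ a : ℝ, 0 < a ∧ ∀ r : ℝ, ν.real {x | r + a < |x|} ≤
      2 * (symmetrization ν).real {x | r < |x|} := by
  have hν' : IsProbabilityMeasure (ν.map ((-1 : ℝ) * ·)) :=
    Measure.isProbabilityMeasure_map (by fun_prop)
  -- If `X' ∈ [-a, a]`, an event of probability at least `1 / 2`, and `|X| > r + a`, then
  -- `|X - X'| > r`.
  obtain ⟨a, ha0, ha⟩ : ∃ a : ℝ, 0 < a ∧ 1 / 2 < ν.real {x | |x| ≤ a} := by
    have hmono : Monotone fun n : ℕ => {x : ℝ | |x| ≤ n} := fun m n hmn x (hx : |x| ≤ m) =>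
      hx.trans (Nat.cast_le.2 hmn)
    have hU : ⋃ n : ℕ, {x : ℝ | |x| ≤ n} = univ :=
      eq_univ_of_forall fun x => mem_iUnion.2 (exists_nat_ge |x|)
    have ht := tendsto_measure_iUnion_atTop (μ := ν) hmono
    rw [hU, measure_univ] at ht
    have ht' := (ENNReal.tendsto_toReal ENNReal.one_ne_top).comp ht
    have h12 : (1 / 2 : ℝ) < ENNReal.toReal 1 := by norm_num
    obtain ⟨n, hn, hn0⟩ := ((ht'.eventually (lt_mem_nhds h12)).and (eventually_gt_atTop 0)).exists
    exact ⟨n, by exact_mod_cast hn0, hn⟩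
  refine ⟨a, ha0, fun r => ?_⟩
  have hB : (ν.map ((-1 : ℝ) * ·)).real {y | |y| ≤ a} = ν.real {x | |x| ≤ a} := by
    rw [map_measureReal_apply (by fun_prop) (measurableSet_le (by fun_prop) (by fun_prop))]
    simp
  have key : ν.real {x | r + a < |x|} * ν.real {x | |x| ≤ a}
      ≤ (symmetrization ν).real {x | r < |x|} := by
    rw [← hB, ← measureReal_prod_prod, symmetrization, Measure.conv,
      map_measureReal_apply (by fun_prop) (measurableSet_lt (by fun_prop) (by fun_prop))]
    refine measureReal_mono ?_
    rintro ⟨x, y⟩ ⟨hx, hy⟩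
    change r + a < |x| at hx
    change |y| ≤ a at hy
    change r < |x + y|
    have := abs_sub_abs_le_abs_sub x (-y)
    rw [abs_neg, sub_neg_eq_add] at this
    linarith
  nlinarith [measureReal_nonneg (μ := ν) (s := {x | r + a < |x|})]

/-- Tails of a fixed point of `T`. The function `1 - |ψ|`, with `ψ` the characteristic function,
dominates nearly twice its own average over `[0, t]`, hence has small averages near `0`, and these
control the tails of the symmetrized law. -/
theorem exists_tail_le_of_T_eq {ν : ProbabilityMeasure ℝ} (hν : T ν = ν) :
    ∃ C : ℝ, 0 ≤ C ∧ ∀ r, 0 < r → (ν : Measure ℝ).real {x | r < |x|} ≤ C * r ^ (-(3 / 4) : ℝ) := by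
  set ψ := charFun (ν : Measure ℝ) with hψ
  have hT : charTransform ψ = ψ := (T_eq_self_iff ν).1 hν
  have hψc : Continuous ψ := continuous_charFun
  have hψ1 : ∀ t, ‖ψ t‖ ≤ 1 := fun t => norm_charFun_le_one t
  have hg := continuous_g
  set q : ℝ → ℝ := fun t => 1 - ‖ψ t‖ with hq
  have hqc : Continuous q := by fun_prop
  have hq0 : ∀ t, 0 ≤ q t := fun t => sub_nonneg.2 (hψ1 t)
  obtain ⟨C, hC0, hC⟩ := exists_integral_le_rpow hqc (by simp [hq, hψ]) hq0
    (fun t => by simp [hq]) fun t => by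
      have h1 : ‖ψ t‖ ≤ ∫ u in (0 : ℝ)..1, ‖ψ (u * t)‖ * ‖ψ ((1 - u) * t)‖ := by
        conv_lhs => rw [← hT]
        refine (intervalIntegral.norm_integral_le_integral_norm zero_le_one).trans_eq ?_
        congr 1 with u
        rw [norm_mul, norm_mul, ← Complex.ofReal_mul, Complex.norm_exp_ofReal_mul_I, mul_one]
      have h2 : ∫ u in (0 : ℝ)..1, (q (u * t) + q ((1 - u) * t) - q (u * t) * q ((1 - u) * t))
          = 1 - ∫ u in (0 : ℝ)..1, ‖ψ (u * t)‖ * ‖ψ ((1 - u) * t)‖ := by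
        have e : ∀ u, q (u * t) + q ((1 - u) * t) - q (u * t) * q ((1 - u) * t)
            = 1 - ‖ψ (u * t)‖ * ‖ψ ((1 - u) * t)‖ := fun u => by simp only [hq]; ring
        simp_rw [e]
        rw [intervalIntegral.integral_sub (by simp)
          ((by fun_prop : Continuous _).intervalIntegrable _ _)]
        simp
      rw [h2]
      simp only [hq]
      linarith
  obtain ⟨a, ha0, ha⟩ := exists_tail_le_symmetrization (ν : Measure ℝ)
  have hsym : ∀ r, 0 < r → (symmetrization (ν : Measure ℝ)).real {x | r < |x|}
      ≤ 2 * C * 2 ^ (7 / 4 : ℝ) * r ^ (-(3 / 4) : ℝ) := by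
    intro r hr
    refine (measureReal_abs_gt_le_integral_charFun hr).trans ?_
    set b := 2 * r⁻¹ with hb
    have hb0 : 0 < b := by positivity
    have hneg : ∫ s in (-b)..0, q s = ∫ s in (0 : ℝ)..b, q s := by
      have := intervalIntegral.integral_comp_neg (a := 0) (b := b) q
      rw [neg_zero] at this
      rw [← this]
      congr 1 with s
      simp only [hq, hψ, charFun_neg, RCLike.norm_conj]
    have h1 : ‖∫ t in (-2 * r⁻¹)..b, 1 - charFun (symmetrization (ν : Measure ℝ)) t‖
        ≤ 4 * ∫ s in (0 : ℝ)..b, q s := by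
      have h2 : ∫ s in (-b)..b, 2 * q s = 4 * ∫ s in (0 : ℝ)..b, q s := by
        rw [intervalIntegral.integral_const_mul,
          ← intervalIntegral.integral_add_adjacent_intervals (hqc.intervalIntegrable (-b) 0)
          (hqc.intervalIntegrable 0 b), hneg]
        ring
      rw [neg_mul, ← hb, ← h2]
      refine intervalIntegral.norm_integral_le_of_norm_le (by linarith)
        (ae_of_all _ fun s _ => ?_) ((by fun_prop : Continuous _).intervalIntegrable _ _)
      rw [charFun_symmetrization, ← Complex.ofReal_one, ← Complex.ofReal_sub, Complex.norm_real,
        Real.norm_of_nonneg]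
      · simp only [hq, ← hψ]
        nlinarith [hψ1 s, norm_nonneg (ψ s)]
      · rw [← hψ]
        nlinarith [hψ1 s, norm_nonneg (ψ s)]
    calc 2⁻¹ * r * ‖∫ t in (-2 * r⁻¹)..b, 1 - charFun (symmetrization (ν : Measure ℝ)) t‖
        ≤ 2⁻¹ * r * (4 * (C * b ^ (7 / 4 : ℝ))) := by
          gcongr
          exact h1.trans (by gcongr; exact hC b hb0)
      _ = 2 * C * 2 ^ (7 / 4 : ℝ) * (r ^ (1 : ℝ) * r ^ (-(7 / 4) : ℝ)) := by
          rw [hb, Real.mul_rpow zero_le_two (by positivity), Real.inv_rpow hr.le,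
            ← Real.rpow_neg hr.le, Real.rpow_one]
          ring
      _ = 2 * C * 2 ^ (7 / 4 : ℝ) * r ^ (-(3 / 4) : ℝ) := by
          rw [← Real.rpow_add hr]
          norm_num
  set D := 2 * (2 * C * 2 ^ (7 / 4 : ℝ)) * 2⁻¹ ^ (-(3 / 4) : ℝ) with hD
  have hD0 : 0 ≤ D := by positivity
  refine ⟨D + (2 * a) ^ (3 / 4 : ℝ), by positivity, fun r hr => ?_⟩
  have hrp : 0 < r ^ (-(3 / 4) : ℝ) := Real.rpow_pos_of_pos hr _
  rcases le_or_gt r (2 * a) with h | h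
  · calc (ν : Measure ℝ).real {x | r < |x|} ≤ 1 := measureReal_le_one
      _ = r ^ (3 / 4 : ℝ) * r ^ (-(3 / 4) : ℝ) := by rw [← Real.rpow_add hr]; norm_num
      _ ≤ (D + (2 * a) ^ (3 / 4 : ℝ)) * r ^ (-(3 / 4) : ℝ) := by
          gcongr
          have : r ^ (3 / 4 : ℝ) ≤ (2 * a) ^ (3 / 4 : ℝ) :=
            Real.rpow_le_rpow hr.le h (by norm_num)
          linarith
  · calc (ν : Measure ℝ).real {x | r < |x|}
        ≤ (ν : Measure ℝ).real {x | 2⁻¹ * r + a < |x|} := by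
          refine measureReal_mono fun x (hx : r < |x|) => ?_
          change 2⁻¹ * r + a < |x|
          linarith
      _ ≤ 2 * (2 * C * 2 ^ (7 / 4 : ℝ) * (2⁻¹ * r) ^ (-(3 / 4) : ℝ)) := by
          refine (ha _).trans ?_
          gcongr
          exact hsym _ (by positivity)
      _ = D * r ^ (-(3 / 4) : ℝ) := by
          rw [Real.mul_rpow (by positivity) hr.le, hD]; ring
      _ ≤ (D + (2 * a) ^ (3 / 4 : ℝ)) * r ^ (-(3 / 4) : ℝ) := by
          gcongr
          have : 0 ≤ (2 * a) ^ (3 / 4 : ℝ) := by positivity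
          linarith

/-- Tails of order `r ^ (-3 / 4)` give `|ψ t - 1| ≤ E min (2, t |X|) = O(t ^ (3 / 4))`, by the layer
cake formula. -/
theorem exists_norm_charFun_sub_one_le_rpow {ν : Measure ℝ} [IsProbabilityMeasure ν] {C : ℝ}
    (hC : ∀ r, 0 < r → ν.real {x | r < |x|} ≤ C * r ^ (-(3 / 4) : ℝ)) :
    ∃ D : ℝ, 0 ≤ D ∧ ∀ t, 0 ≤ t → ‖charFun ν t - 1‖ ≤ D * t ^ (3 / 4 : ℝ) := by
  have hC0 : 0 ≤ C := by simpa using measureReal_nonneg.trans (hC 1 one_pos)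
  set A := ∫ s in Ioc (0 : ℝ) 2, s ^ (-(3 / 4) : ℝ) with hA
  have hA0 : 0 ≤ A := setIntegral_nonneg measurableSet_Ioc fun s hs => Real.rpow_nonneg hs.1.le _
  have hAi : IntegrableOn (fun s : ℝ => s ^ (-(3 / 4) : ℝ)) (Ioc 0 2) :=
    (intervalIntegrable_iff_integrableOn_Ioc_of_le zero_le_two).1
      (intervalIntegral.intervalIntegrable_rpow' (by norm_num))
  refine ⟨C * 2 ^ (3 / 4 : ℝ) * A, by positivity, fun t ht => ?_⟩
  rcases ht.eq_or_lt with rfl | ht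
  · simp [Real.zero_rpow]
  have hm : Integrable (fun x : ℝ => min 2 (t * |x|)) ν := by
    refine (integrable_const (2 : ℝ)).mono' (by fun_prop) (ae_of_all _ fun x => ?_)
    rw [Real.norm_of_nonneg (by positivity)]
    exact min_le_left _ _
  have hexp : Integrable (fun x : ℝ => Complex.exp (t * x * Complex.I)) ν := by
    refine (integrable_const (1 : ℝ)).mono' (by fun_prop) (ae_of_all _ fun x => ?_)
    rw [← Complex.ofReal_mul, Complex.norm_exp_ofReal_mul_I]
  have h1 : ‖charFun ν t - 1‖ ≤ ∫ x, min 2 (t * |x|) ∂ν := by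
    have : charFun ν t - 1 = ∫ x, (Complex.exp (t * x * Complex.I) - 1) ∂ν := by
      rw [integral_sub hexp (integrable_const _), charFun_apply_real]
      simp
    rw [this]
    refine norm_integral_le_of_norm_le hm (ae_of_all _ fun x => le_min ?_ ?_)
    · refine (norm_sub_le _ _).trans ?_
      rw [← Complex.ofReal_mul, Complex.norm_exp_ofReal_mul_I, norm_one]
      norm_num
    · have := Real.norm_exp_I_mul_ofReal_sub_one_le (x := t * x)
      rw [mul_comm Complex.I, Complex.ofReal_mul, Real.norm_eq_abs, abs_mul, abs_of_pos ht] at this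
      exact this
  refine h1.trans ?_
  rw [hm.integral_eq_integral_Ioc_meas_le (M := 2) (ae_of_all _ fun x => by positivity)
    (ae_of_all _ fun x => min_le_left _ _)]
  have h2 : ∀ s ∈ Ioc (0 : ℝ) 2, ν.real {x | s ≤ min 2 (t * |x|)}
      ≤ C * 2 ^ (3 / 4 : ℝ) * t ^ (3 / 4 : ℝ) * s ^ (-(3 / 4) : ℝ) := by
    intro s hs
    have hst : 0 < s * (2 * t)⁻¹ := mul_pos hs.1 (by positivity)
    calc ν.real {x | s ≤ min 2 (t * |x|)} ≤ ν.real {x | s * (2 * t)⁻¹ < |x|} := by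
          refine measureReal_mono fun x (hx : s ≤ min 2 (t * |x|)) => ?_
          change s * (2 * t)⁻¹ < |x|
          have := hx.trans (min_le_right _ _)
          rw [mul_inv_lt_iff₀ (by positivity)]
          linarith [hs.1]
      _ ≤ C * (s * (2 * t)⁻¹) ^ (-(3 / 4) : ℝ) := hC _ hst
      _ = C * 2 ^ (3 / 4 : ℝ) * t ^ (3 / 4 : ℝ) * s ^ (-(3 / 4) : ℝ) := by
          rw [Real.mul_rpow hs.1.le (by positivity), Real.inv_rpow (by positivity),
            ← Real.rpow_neg (by positivity), neg_neg, Real.mul_rpow zero_le_two ht.le]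
          ring
  calc ∫ s in Ioc (0 : ℝ) 2, ν.real {x | s ≤ min 2 (t * |x|)}
      ≤ ∫ s in Ioc (0 : ℝ) 2, C * 2 ^ (3 / 4 : ℝ) * t ^ (3 / 4 : ℝ) * s ^ (-(3 / 4) : ℝ) :=
        integral_mono_of_nonneg (ae_of_all _ fun s => measureReal_nonneg) (hAi.const_mul _)
          ((ae_restrict_iff' measurableSet_Ioc).2 (ae_of_all _ h2))
    _ = C * 2 ^ (3 / 4 : ℝ) * A * t ^ (3 / 4 : ℝ) := by
        rw [integral_const_mul, ← hA]; ring

/-- The quadratic terms and the toll contribute only `O(t ^ (3 / 2))` to the fixed-point equation,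
whose linear part says that `ψ - 1` is twice its own average over `[0, t]`. -/
theorem norm_sub_average_le {f : ℝ → ℂ} (hf : Continuous f) (hf1 : ∀ t, ‖f t‖ ≤ 1)
    (hT : charTransform f = f) {D : ℝ} (hD0 : 0 ≤ D)
    (hD : ∀ t, 0 ≤ t → ‖f t - 1‖ ≤ D * t ^ (3 / 4 : ℝ)) {t : ℝ} (ht : 0 < t) (ht1 : t ≤ 1) :
    ‖(f t - 1) - 2 * ∫ u in (0 : ℝ)..1, (f (u * t) - 1)‖
      ≤ (D ^ 2 + 75 + 10 * D) * t ^ (3 / 2 : ℝ) := by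
  have hg := continuous_g
  have hsymm := integral_comp_one_sub fun u => f (u * t) - 1
  have h0 : ∫ u in (0 : ℝ)..1, ((t * g u : ℝ) : ℂ) * Complex.I = 0 := by
    rw [intervalIntegral.integral_mul_const, intervalIntegral.integral_ofReal,
      intervalIntegral.integral_const_mul, integral_g]
    simp
  have e : (f t - 1) - 2 * ∫ u in (0 : ℝ)..1, (f (u * t) - 1) =
      ∫ u in (0 : ℝ)..1, ((f (u * t) * f ((1 - u) * t) * Complex.exp (t * g u * Complex.I) - 1)
        - (f (u * t) - 1) - (f ((1 - u) * t) - 1) - ((t * g u : ℝ) : ℂ) * Complex.I) := by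
    have hlin : ∀ A B B' Z : ℝ → ℂ, Continuous A → Continuous B → Continuous B' → Continuous Z →
        ∫ u in (0 : ℝ)..1, (A u - 1 - B u - B' u - Z u) = (∫ u in (0 : ℝ)..1, A u) - 1
          - (∫ u in (0 : ℝ)..1, B u) - (∫ u in (0 : ℝ)..1, B' u) - ∫ u in (0 : ℝ)..1, Z u := by
      intro A B B' Z hA hB hB' hZ
      rw [intervalIntegral.integral_sub, intervalIntegral.integral_sub,
        intervalIntegral.integral_sub, intervalIntegral.integral_sub,
        intervalIntegral.integral_const, sub_zero, one_smul]
      all_goals exact (by fun_prop : Continuous _).intervalIntegrable _ _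
    rw [hlin _ _ _ _ (by fun_prop) (by fun_prop) (by fun_prop) (by fun_prop), h0, hsymm]
    have : f t = ∫ u in (0 : ℝ)..1,
        f (u * t) * f ((1 - u) * t) * Complex.exp (t * g u * Complex.I) := by
      conv_lhs => rw [← hT]
      rfl
    rw [← this]
    ring
  rw [e]
  refine (intervalIntegral.norm_integral_le_of_norm_le_const
    (C := (D ^ 2 + 75 + 10 * D) * t ^ (3 / 2 : ℝ)) fun u hu => ?_).trans (by simp)
  rw [uIoc_of_le zero_le_one] at hu
  set ε := D * t ^ (3 / 4 : ℝ) with hε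
  have hε0 : 0 ≤ ε := by positivity
  have hw : ∀ s, 0 ≤ s → s ≤ t → ‖f s - 1‖ ≤ ε := fun s hs hst =>
    (hD s hs).trans (by rw [hε]; gcongr)
  have ha := hw (u * t) (mul_nonneg hu.1.le ht.le) (mul_le_of_le_one_left ht.le hu.2)
  have hb := hw ((1 - u) * t) (mul_nonneg (by linarith [hu.2]) ht.le)
    (mul_le_of_le_one_left ht.le (by linarith [hu.1]))
  set x := f (u * t) with hx
  set y := f ((1 - u) * t) with hy
  have hx1 : ‖x‖ ≤ 1 := hf1 _
  have hy1 : ‖y‖ ≤ 1 := hf1 _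
  set z : ℂ := ((t * g u : ℝ) : ℂ) * Complex.I with hz
  have hgu := abs_g_le hu.1.le hu.2
  have hzn : ‖z‖ ≤ 5 * t := by
    rw [hz, norm_mul, Complex.norm_I, mul_one, Complex.norm_real, Real.norm_eq_abs, abs_mul,
      abs_of_pos ht]
    nlinarith
  have hzexp : ‖Complex.exp z - 1 - z‖ ≤ 75 * t ^ 2 := by
    refine (norm_exp_mul_I_sub_one_sub_le _).trans ?_
    have h2 : g u ^ 2 ≤ 25 := by rw [← sq_abs]; nlinarith [abs_nonneg (g u)]
    nlinarith [mul_le_mul_of_nonneg_left h2 (sq_nonneg t)]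
  have hz' : Complex.exp (t * g u * Complex.I) = Complex.exp z := by rw [hz]; push_cast; rfl
  have hxy : ‖x * y - 1‖ ≤ 2 * ε := by
    have : x * y - 1 = (x - 1) * y + (y - 1) := by ring
    rw [this]
    refine (norm_add_le _ _).trans ?_
    rw [norm_mul]
    have := mul_le_of_le_one_right (norm_nonneg (x - 1)) hy1
    linarith
  have hxy1 : ‖x * y‖ ≤ 1 := by
    rw [norm_mul]; exact mul_le_one₀ hx1 (norm_nonneg _) hy1
  have key : x * y * Complex.exp (t * g u * Complex.I) - 1 - (x - 1) - (y - 1) - z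
      = (x - 1) * (y - 1) + x * y * (Complex.exp z - 1 - z) + z * (x * y - 1) := by
    rw [hz']; ring
  have hp1 : ε ^ 2 = D ^ 2 * t ^ (3 / 2 : ℝ) := by
    rw [hε, mul_pow, ← Real.rpow_natCast (t ^ (3 / 4 : ℝ)), ← Real.rpow_mul ht.le]
    norm_num
  have hp2 : t ^ 2 ≤ t ^ (3 / 2 : ℝ) := by
    rw [← Real.rpow_natCast]
    exact Real.rpow_le_rpow_of_exponent_ge ht ht1 (by norm_num)
  have hp3 : t * ε ≤ D * t ^ (3 / 2 : ℝ) := by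
    have h1 : t * t ^ (3 / 4 : ℝ) = t ^ (7 / 4 : ℝ) := by
      rw [← Real.rpow_one_add' ht.le (by norm_num)]; norm_num
    have h2 : t ^ (7 / 4 : ℝ) ≤ t ^ (3 / 2 : ℝ) :=
      Real.rpow_le_rpow_of_exponent_ge ht ht1 (by norm_num)
    rw [hε, mul_left_comm, h1]
    gcongr
  rw [key]
  calc ‖(x - 1) * (y - 1) + x * y * (Complex.exp z - 1 - z) + z * (x * y - 1)‖
      ≤ ‖x - 1‖ * ‖y - 1‖ + ‖x * y‖ * ‖Complex.exp z - 1 - z‖ + ‖z‖ * ‖x * y - 1‖ := by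
        refine (norm_add₃_le).trans ?_
        rw [norm_mul (x - 1), norm_mul (x * y), norm_mul z]
    _ ≤ ε * ε + 1 * (75 * t ^ 2) + 5 * t * (2 * ε) := by gcongr
    _ ≤ (D ^ 2 + 75 + 10 * D) * t ^ (3 / 2 : ℝ) := by nlinarith

/-- The characteristic function of a fixed point has a right derivative at `0`, the value of which
is `i m - σ` for the center `m` and the scale `σ ≥ 0` of the Cauchy factor. -/
theorem exists_hasDerivWithinAt_charFun {ν : ProbabilityMeasure ℝ} (hν : T ν = ν) :
    ∃ c : ℂ, c.re ≤ 0 ∧ HasDerivWithinAt (charFun (ν : Measure ℝ)) c (Ioi 0) 0 := by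
  obtain ⟨C, -, hC⟩ := exists_tail_le_of_T_eq hν
  obtain ⟨D, hD0, hD⟩ := exists_norm_charFun_sub_one_le_rpow hC
  have hψc : Continuous (charFun (ν : Measure ℝ)) := continuous_charFun
  obtain ⟨c, hc⟩ := exists_tendsto_div_of_average
    (w := fun t => charFun (ν : Measure ℝ) t - 1) (by fun_prop)
    fun t ht ht1 => norm_sub_average_le hψc (fun t => norm_charFun_le_one t)
      ((T_eq_self_iff ν).1 hν) hD0 hD ht ht1
  refine ⟨c, ?_, ?_⟩
  · refine le_of_tendsto ((Complex.continuous_re.tendsto c).comp hc) ?_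
    filter_upwards [self_mem_nhdsWithin] with t ht
    have h1 : (charFun (ν : Measure ℝ) t).re ≤ 1 :=
      (Complex.re_le_norm _).trans (norm_charFun_le_one t)
    simp only [Function.comp_apply, Complex.div_ofReal_re, Complex.sub_re, Complex.one_re]
    exact div_nonpos_of_nonpos_of_nonneg (by linarith) (le_of_lt ht)
  · rw [hasDerivWithinAt_iff_tendsto_slope' (by simp)]
    refine hc.congr fun t => ?_
    rw [slope_def_module, sub_zero, charFun_zero, Complex.real_smul]
    simp [div_eq_inv_mul]

/-! ### Classification of the fixed points -/

theorem charFun_convCauchy (μ : ProbabilityMeasure ℝ) (m : ℝ) (σ : ℝ≥0) (t : ℝ) :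
    charFun (convCauchy μ m σ : Measure ℝ) t =
      charFun (μ : Measure ℝ) t * Complex.exp (t * m * Complex.I - σ * |t|) := by
  rw [← charFun_cauchyMeasure]
  exact charFun_conv t

theorem T_convCauchy {μ : ProbabilityMeasure ℝ} (hμ : T μ = μ) (m : ℝ) (σ : ℝ≥0) :
    T (convCauchy μ m σ) = convCauchy μ m σ := by
  rw [T_eq_self_iff] at hμ ⊢
  ext t
  rw [charFun_convCauchy]
  conv_rhs => rw [← hμ]
  rw [charTransform, charTransform, ← intervalIntegral.integral_mul_const]
  refine intervalIntegral.integral_congr fun u hu => ?_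
  rw [uIcc_of_le zero_le_one] at hu
  simp only [charFun_convCauchy]
  have : Complex.exp (t * m * Complex.I - σ * |t|)
      = Complex.exp ((u * t : ℝ) * m * Complex.I - σ * |u * t|) *
        Complex.exp (((1 - u) * t : ℝ) * m * Complex.I - σ * |(1 - u) * t|) := by
    rw [← Complex.exp_add, abs_mul, abs_mul, abs_of_nonneg hu.1,
      abs_of_nonneg (sub_nonneg.2 hu.2)]
    congr 1
    push_cast
    ring
  rw [this]
  ring

theorem IsLimitLaw.hasDerivWithinAt {μ : ProbabilityMeasure ℝ} (hμ : IsLimitLaw μ) :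
    HasDerivWithinAt (charFun (μ : Measure ℝ)) 0 (Ioi 0) 0 := by
  have := hasDerivAt_charFun_zero hμ.finite_variance
  rw [hμ.zero_mean] at this
  simpa using this.hasDerivWithinAt

theorem hasDerivWithinAt_charFun_convCauchy {μ : ProbabilityMeasure ℝ} (hμ : IsLimitLaw μ)
    (m : ℝ) (σ : ℝ≥0) :
    HasDerivWithinAt (charFun (convCauchy μ m σ : Measure ℝ)) (m * Complex.I - σ) (Ioi 0) 0 := by
  have h2 : HasDerivAt (fun t : ℝ => Complex.exp ((t : ℂ) * (m * Complex.I - σ)))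
      (m * Complex.I - σ) 0 := by
    have := ((Complex.ofRealCLM.hasDerivAt (x := 0)).mul_const (m * Complex.I - σ : ℂ)).cexp
    simpa using this
  have h3 := hμ.hasDerivWithinAt.mul h2.hasDerivWithinAt
  rw [charFun_zero] at h3
  refine (h3.congr (fun t ht => ?_) ?_).congr_deriv (by simp)
  · rw [charFun_convCauchy, abs_of_pos ht, Pi.mul_apply]
    congr 2
    ring
  · simp

/-- Fixed points of `T` are determined by the right derivative at `0` of their characteristic
functions. -/
theorem eq_of_T_eq_of_hasDerivWithinAt {μ ν : ProbabilityMeasure ℝ} {c : ℂ} (hμ : T μ = μ)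
    (hν : T ν = ν) (hμd : HasDerivWithinAt (charFun (μ : Measure ℝ)) c (Ioi 0) 0)
    (hνd : HasDerivWithinAt (charFun (ν : Measure ℝ)) c (Ioi 0) 0) : μ = ν := by
  have hpos : ∀ t, 0 < t → charFun (μ : Measure ℝ) t = charFun (ν : Measure ℝ) t := fun t ht =>
    eq_of_hasDerivWithinAt continuous_charFun continuous_charFun
      (fun t => norm_charFun_le_one t) (fun t => norm_charFun_le_one t) (by simp)
      ((T_eq_self_iff μ).1 hμ) ((T_eq_self_iff ν).1 hν) hμd hνd ht
  refine Subtype.ext (Measure.ext_of_charFun (μ := (μ : Measure ℝ)) (ν := (ν : Measure ℝ)) ?_)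
  ext t
  rcases lt_trichotomy t 0 with ht | rfl | ht
  · have := hpos (-t) (neg_pos.2 ht)
    rwa [charFun_neg, charFun_neg, (starRingEnd ℂ).injective.eq_iff] at this
  · simp
  · exact hpos t ht

theorem fixedPoints_eq {μ : ProbabilityMeasure ℝ} (hμ : IsLimitLaw μ) :
    fixedPoints = cauchyConvolutions μ := by
  ext ν
  constructor
  · intro hν
    obtain ⟨c, hc, hd⟩ := exists_hasDerivWithinAt_charFun hν
    obtain ⟨σ, hσ⟩ : ∃ σ : ℝ≥0, (σ : ℝ) = -c.re := ⟨⟨-c.re, neg_nonneg.2 hc⟩, rfl⟩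
    refine ⟨c.im, σ, ?_⟩
    refine eq_of_T_eq_of_hasDerivWithinAt hν (T_convCauchy hμ.fixed _ _) hd ?_
    convert! hasDerivWithinAt_charFun_convCauchy hμ _ _
    apply Complex.ext
    · simp [hσ]
    · simp
  · rintro ⟨m, σ, rfl⟩
    exact T_convCauchy hμ.fixed m σ

theorem convCauchy_injective {μ : ProbabilityMeasure ℝ} (hμ : IsLimitLaw μ) :
    Function.Injective fun p : ℝ × ℝ≥0 => convCauchy μ p.1 p.2 := by
  rintro ⟨m, σ⟩ ⟨m', σ'⟩ h
  have h1 := hasDerivWithinAt_charFun_convCauchy hμ m σ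
  simp only at h
  rw [h] at h1
  have := (uniqueDiffWithinAt_Ioi (0 : ℝ)).eq_deriv _ h1
    (hasDerivWithinAt_charFun_convCauchy hμ m' σ')
  have hre := congrArg Complex.re this
  have him := congrArg Complex.im this
  simp at hre him
  simp [hre, him]

end Quicksort

theorem theorem1 :
    (∃! μ : ProbabilityMeasure ℝ, Quicksort.IsLimitLaw μ) ∧
    ∀ μ : ProbabilityMeasure ℝ, Quicksort.IsLimitLaw μ →
      Quicksort.fixedPoints = Quicksort.cauchyConvolutions μ ∧
      Set.BijOn (fun p : ℝ × ℝ≥0 => Quicksort.convCauchy μ p.1 p.2)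
        Set.univ Quicksort.fixedPoints := by
  refine ⟨?_, fun μ hμ => ⟨Quicksort.fixedPoints_eq hμ, ?_, ?_, ?_⟩⟩
  · obtain ⟨μ, hμ⟩ := Quicksort.exists_isLimitLaw
    exact ⟨μ, hμ, fun ν hν => Quicksort.eq_of_T_eq_of_hasDerivWithinAt hν.fixed hμ.fixed
      hν.hasDerivWithinAt hμ.hasDerivWithinAt⟩
  · exact fun p _ => Quicksort.T_convCauchy hμ.fixed p.1 p.2
  · exact (Quicksort.convCauchy_injective hμ).injOn
  · intro ν hν
    rw [Quicksort.fixedPoints_eq hμ] at hν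
    obtain ⟨m, σ, rfl⟩ := hν
    exact ⟨(m, σ), Set.mem_univ _, rfl⟩
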